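/- Let $V$ be a finite-dimensional complex vector space with its usual topology, let $T\in\operatorname{End}(V)$, and let $C(T)=\{U\in \mathrm{GL}(V) : UT=TU\}$ be its centralizer group. Order the set of $C(T)$-orbits in $V$ by inclusion of closures: $O\le O'$ if and only if $\overline{O}\subseteq\overline{O'}$. For an eigenvalue $\lambda$ of $T$ let $i_1<i_2<\dots<i_m$ be the distinct sizes of the Jordan blocks of $T$ with eigenvalue $\lambda$, and let $\Delta^\lambda=(\Delta^\lambda_k)_{k\ge 1}$ be its sequence of block increments: $\Delta^\lambda_1=i_1$, $\Delta^\lambda_k=i_k-i_{k-1}$ for $1<k\le m$, and $\Delta^\lambda_k=0$ for $k>m$. For a sequence $\Delta=(\Delta_k)_{k\ge1}$ of natural numbers let $\Gamma_\Delta=\prod_k\{0,1,\dots,\Delta_k\}$, partially ordered by $$r\le s \iff \sum_{i\le k} r_i\le\sum_{i\le k}s_i \text{ for all } k.$$ Then the $C(T)$-orbits form a lattice, in which the closure of the join of two orbits is the sum of their closures and the closure of the meet is the intersection of their closures, and this lattice is isomorphic to the Cartesian product (with the componentwise order) $$\prod_{\lambda\in\mathrm{Spec}(T)}\Gamma_{\Delta^\lambda}.$$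 -/

import Mathlib

open Polynomial
open scoped DirectSum Pointwise

/-- The centralizer group `C(T)` of a linear operator `T`: all `U ∈ GL(V)` with `U T = T U`. -/
def centralizerGroup {V : Type*} [AddCommGroup V] [Module ℂ V] (T : Module.End ℂ V) :
    Subgroup (LinearMap.GeneralLinearGroup ℂ V) where
  carrier := {U | (U : Module.End ℂ V) * T = T * (U : Module.End ℂ V)}
  one_mem' := by simp
  mul_mem' := by
    intro a b ha hb
    have h : Commute ((a * b : LinearMap.GeneralLinearGroup ℂ V) : Module.End ℂ V) T := by
      rw [Units.val_mul]
      exact Commute.mul_left ha hb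
    exact h
  inv_mem' := by
    intro a ha
    exact Commute.units_inv_left (u := a) ha

/-- The set of orbits of `C(T)` acting on `V` by evaluation. -/
abbrev CentralizerOrbit {V : Type*} [AddCommGroup V] [Module ℂ V] (T : Module.End ℂ V) : Type _ :=
  MulAction.orbitRel.Quotient (centralizerGroup T) V

/-- A Jordan decomposition of `T`: an isomorphism of the `ℂ[X]`-module `V` (on which `X` acts
as `T`) with a finite direct sum of cyclic modules `ℂ[X] / (X - μ_j) ^ n_j`, `n_j ≥ 1`, that is,
a decomposition of `V` into Jordan blocks with eigenvalues `μ_j` and sizes `n_j`. -/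
structure JordanDecomposition {V : Type*} [AddCommGroup V] [Module ℂ V]
    (T : Module.End ℂ V) where
  /-- the number of blocks -/
  numBlocks : ℕ
  /-- the eigenvalue of each block -/
  eigenvalue : Fin numBlocks → ℂ
  /-- the size of each block -/
  size : Fin numBlocks → ℕ
  size_pos : ∀ j, 0 < size j
  /-- the decomposition into cyclic modules -/
  equiv : Module.AEval' T ≃ₗ[ℂ[X]]
    ⨁ j : Fin numBlocks, ℂ[X] ⧸ Ideal.span {(X - C (eigenvalue j)) ^ size j}

/-- The set `B` of sizes of the Jordan blocks of `T` for the eigenvalue `μ`. -/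
def jordanBlockSizes {V : Type*} [AddCommGroup V] [Module ℂ V] (T : Module.End ℂ V) (μ : ℂ) :
    Set ℕ :=
  {n | ∃ (D : JordanDecomposition T) (j : Fin D.numBlocks), D.eigenvalue j = μ ∧ D.size j = n}

/-- The block increments of `B = {i_0 < i_1 < ⋯}`, indexed from `0`: the first is `i_0`, and the
`(k + 1)`-st is `i_{k+1} - i_k`. For finite `B` the sequence is continued by zeros, since
`Nat.nth` is `0` beyond the last element of a finite set and the subtraction is truncated. -/
noncomputable def blockIncrement (B : Set ℕ) : ℕ → ℕ
  | 0 => Nat.nth (· ∈ B) 0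
  | k + 1 => Nat.nth (· ∈ B) (k + 1) - Nat.nth (· ∈ B) k

/-- The set `Γ_Δ = ∏_k {0, …, Δ_k}`. It is a definition of its own (not an abbreviation) because
it carries the order by partial sums, and not the componentwise order. -/
def IncrementPoset (Δ : ℕ → ℕ) : Type :=
  ∀ k : ℕ, Fin (Δ k + 1)

/-- The order of `Γ_Δ`: `r ≤ s` iff `∑_{i ≤ k} r_i ≤ ∑_{i ≤ k} s_i` for all `k`. -/
instance (Δ : ℕ → ℕ) : PartialOrder (IncrementPoset Δ) where
  le r s := ∀ k : ℕ, ∑ i ∈ Finset.range (k + 1), (r i : ℕ) ≤ ∑ i ∈ Finset.range (k + 1), (s i : ℕ)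
  le_refl _ _ := le_rfl
  le_trans _ _ _ h₁ h₂ k := (h₁ k).trans (h₂ k)
  le_antisymm r s h₁ h₂ := by
    have h : ∀ k : ℕ,
        ∑ i ∈ Finset.range k, (r i : ℕ) = ∑ i ∈ Finset.range k, (s i : ℕ) := by
      intro k
      cases k with
      | zero => simp
      | succ k => exact le_antisymm (h₁ k) (h₂ k)
    funext k
    have h3 := h (k + 1)
    rw [Finset.sum_range_succ, Finset.sum_range_succ, h k] at h3
    exact Fin.ext (Nat.add_left_cancel h3)

/-! Regard `V` as a `ℂ[X]`-module with `X` acting as `T`. The centralizer algebra is its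
endomorphism ring `E`, and `C(T)` is the unit group of `E`. Any `S` in `E` becomes invertible after
adding all but finitely many scalars `t`. Letting `t → 0` shows that the closure of the orbit of `v`
is the cyclic submodule `E v` (`closure_orbit_eq`); a suitable `t` shows that vectors generating the
same submodule share an orbit (`mem_orbit_of_mutually_cyclic`). Every `E`-submodule is cyclic, so
orbits correspond to hyperinvariant subspaces, with sum as join and intersection as meet.

It remains to compute this lattice. In a Jordan decomposition with sizes `n j`, a hyperinvariant
subspace is cut out by requiring `(X - μ_j) ^ b j` to kill the `j`-th coordinate, where `b ≤ n` and,
for each eigenvalue, `b` and `n - b` are nondecreasing in `n` (`exists_eq_hyperinvariantSubmodule`).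
So `b` depends only on eigenvalue and size, and its successive differences are bounded exactly by
the block increments: `b` records the partial sums of a point of `Γ_Δ`, and inclusion compares
partial sums. -/

/-! ### Cyclic modules `R ⧸ p ^ n` and maps between them -/

section PrimePowerQuotient

variable {R : Type*} [CommRing R]

theorem pow_smul_mk_eq_zero_iff {p : R} {n a : ℕ} (x : R) :
    p ^ a • (Ideal.Quotient.mk (Ideal.span {p ^ n}) x) = 0 ↔ p ^ n ∣ p ^ a * x := by
  rw [← Ideal.mem_span_singleton, ← Ideal.Quotient.eq_zero_iff_mem, map_mul, Algebra.smul_def]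
  rfl

theorem pow_smul_quotient_eq_zero {p : R} {n a : ℕ} (h : n ≤ a)
    (y : R ⧸ Ideal.span {p ^ n}) : p ^ a • y = 0 := by
  obtain ⟨x, rfl⟩ := Ideal.Quotient.mk_surjective y
  exact (pow_smul_mk_eq_zero_iff x).2 ((pow_dvd_pow p h).mul_right x)

theorem pow_smul_one_quotient_eq_zero_iff [IsDomain R] {p : R} (hp : Prime p) {n a : ℕ} :
    p ^ a • (1 : R ⧸ Ideal.span {p ^ n}) = 0 ↔ n ≤ a := by
  rw [← map_one (Ideal.Quotient.mk _), pow_smul_mk_eq_zero_iff, mul_one,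
    pow_dvd_pow_iff hp.ne_zero hp.not_isUnit]

theorem exists_eq_pow_smul_of_pow_smul_eq_zero [IsDomain R] {p : R} (hp : p ≠ 0) {n b : ℕ}
    (hb : b ≤ n) {y : R ⧸ Ideal.span {p ^ n}} (hy : p ^ b • y = 0) :
    ∃ z : R, y = p ^ (n - b) • Ideal.Quotient.mk _ z := by
  obtain ⟨x, rfl⟩ := Ideal.Quotient.mk_surjective y
  rw [pow_smul_mk_eq_zero_iff, ← Nat.add_sub_of_le hb, pow_add,
    mul_dvd_mul_iff_left (pow_ne_zero _ hp)] at hy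
  obtain ⟨z, rfl⟩ := hy
  refine ⟨z, ?_⟩
  rw [map_mul, Algebra.smul_def]
  simp

/-- Both elements are multiples of `p ^ (n - b - 1)`, and the cofactor of `z` is prime to `p`, hence
invertible modulo `p ^ n`. -/
theorem exists_eq_smul_of_pow_smul_eq_zero [IsDomain R] [IsPrincipalIdealRing R] {p : R}
    (hp : Prime p) {n b : ℕ} (hb : b < n) {y z : R ⧸ Ideal.span {p ^ n}}
    (hy : p ^ (b + 1) • y = 0) (hz : p ^ (b + 1) • z = 0) (hz' : p ^ b • z ≠ 0) :
    ∃ r : R, y = r • z := by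
  obtain ⟨y', rfl⟩ := exists_eq_pow_smul_of_pow_smul_eq_zero hp.ne_zero hb hy
  obtain ⟨z', rfl⟩ := exists_eq_pow_smul_of_pow_smul_eq_zero hp.ne_zero hb hz
  have hndvd : ¬ p ∣ z' := by
    rintro ⟨w, rfl⟩
    apply hz'
    rw [smul_smul, ← pow_add, pow_smul_mk_eq_zero_iff, ← mul_assoc, ← pow_succ]
    exact (pow_dvd_pow p (by omega)).mul_right w
  obtain ⟨s, t, hst⟩ : IsCoprime (p ^ n) z' :=
    ((Irreducible.coprime_iff_not_dvd hp.irreducible).2 hndvd).pow_left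
  refine ⟨y' * t, ?_⟩
  have h1 : Ideal.Quotient.mk (Ideal.span {p ^ n}) (t * z') = 1 := by
    rw [← map_one (Ideal.Quotient.mk _), Ideal.Quotient.eq, ← hst, Ideal.mem_span_singleton]
    exact ⟨-s, by ring⟩
  rw [smul_comm]
  congr 1
  rw [← mul_one (Ideal.Quotient.mk _ y'), ← h1, Algebra.smul_def, ← map_mul]
  change _ = Ideal.Quotient.mk _ (y' * t) * _
  rw [← map_mul, mul_assoc]

theorem eq_zero_of_isCoprime_of_pow_smul_eq_zero {M : Type*} [AddCommGroup M] [Module R M]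
    {p q : R} (h : IsCoprime p q) {a b : ℕ} {y : M} (hp : p ^ a • y = 0) (hq : q ^ b • y = 0) :
    y = 0 := by
  obtain ⟨s, t, hst⟩ := h.pow (m := a) (n := b)
  rw [← one_smul R y, ← hst, add_smul, mul_smul, mul_smul, hp, hq]
  simp

/-- For `n ≤ m`, `g` preserves annihilators. For `m ≤ n`, `y` is divisible by `p ^ (n - b)`, so `g
y` is too. For coprime primes `g` vanishes. -/
theorem pow_smul_map_eq_zero [IsDomain R] {p q : R} (hp : p ≠ 0)
    (h : p = q ∨ IsCoprime p q) {n m b c : ℕ} (hb : b ≤ n)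
    (hle : p = q → n ≤ m → b ≤ c) (hge : p = q → m ≤ n → b + m ≤ c + n)
    (g : (R ⧸ Ideal.span {p ^ n}) →ₗ[R] (R ⧸ Ideal.span {q ^ m}))
    {y : R ⧸ Ideal.span {p ^ n}} (hy : p ^ b • y = 0) : q ^ c • g y = 0 := by
  rcases h with rfl | h
  · rcases le_total n m with hnm | hnm
    · rw [← Nat.sub_add_cancel (hle rfl hnm), pow_add, mul_smul, ← map_smul g (p ^ b), hy]
      simp
    · have := hge rfl hnm
      obtain ⟨z, rfl⟩ := exists_eq_pow_smul_of_pow_smul_eq_zero hp hb hy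
      rw [map_smul, smul_smul, ← pow_add]
      exact pow_smul_quotient_eq_zero (by omega) _
  · rw [eq_zero_of_isCoprime_of_pow_smul_eq_zero h (a := b) (b := m) (y := g y), smul_zero]
    · rw [← map_smul, hy, map_zero]
    · exact pow_smul_quotient_eq_zero le_rfl _

/-- For `n ≤ m`, multiplication by `p ^ (m - n)` as an injection `R ⧸ p ^ n → R ⧸ p ^ m`. -/
theorem exists_linearMap_mk_eq_pow_smul (p : R) {n m : ℕ} (h : n ≤ m) :
    ∃ g : (R ⧸ Ideal.span {p ^ n}) →ₗ[R] (R ⧸ Ideal.span {p ^ m}),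
      ∀ x : R, g (Ideal.Quotient.mk _ x) = p ^ (m - n) • Ideal.Quotient.mk _ x := by
  refine ⟨Submodule.mapQ (Ideal.span {p ^ n}) (Ideal.span {p ^ m})
    (LinearMap.lsmul R R (p ^ (m - n))) ?_, fun x ↦ rfl⟩
  intro x hx
  rw [Ideal.mem_span_singleton] at hx
  rw [Submodule.mem_comap, Ideal.mem_span_singleton, LinearMap.lsmul_apply, smul_eq_mul,
    ← Nat.sub_add_cancel h, pow_add]
  simpa using mul_dvd_mul_left (p ^ (m - n)) hx

/-- For `m ≤ n`, the projection `R ⧸ p ^ n → R ⧸ p ^ m`. -/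
theorem exists_linearMap_mk_eq_mk (p : R) {n m : ℕ} (h : m ≤ n) :
    ∃ g : (R ⧸ Ideal.span {p ^ n}) →ₗ[R] (R ⧸ Ideal.span {p ^ m}),
      ∀ x : R, g (Ideal.Quotient.mk _ x) = Ideal.Quotient.mk _ x := by
  refine ⟨Submodule.mapQ (Ideal.span {p ^ n}) (Ideal.span {p ^ m}) LinearMap.id ?_, fun x ↦ rfl⟩
  intro x hx
  rw [Ideal.mem_span_singleton] at hx
  rw [Submodule.mem_comap, Ideal.mem_span_singleton]
  exact (pow_dvd_pow p h).trans hx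

theorem exists_linearMap_detecting_of_le [IsDomain R] {p q : R} (hp : p ≠ 0) (hpq : p = q)
    {n m : ℕ} (h : n ≤ m) :
    ∃ g : (R ⧸ Ideal.span {p ^ n}) →ₗ[R] (R ⧸ Ideal.span {q ^ m}),
      ∀ c y, q ^ c • g y = 0 → p ^ c • y = 0 := by
  subst hpq
  obtain ⟨g, hg⟩ := exists_linearMap_mk_eq_pow_smul p h
  refine ⟨g, fun c y hy ↦ ?_⟩
  obtain ⟨x, rfl⟩ := Ideal.Quotient.mk_surjective y
  rw [hg, smul_smul, ← pow_add, pow_smul_mk_eq_zero_iff] at hy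
  rw [pow_smul_mk_eq_zero_iff, ← mul_dvd_mul_iff_left (pow_ne_zero (m - n) hp), ← mul_assoc,
    ← pow_add, ← pow_add, Nat.sub_add_cancel h, add_comm]
  exact hy

theorem exists_linearMap_detecting_of_ge {p q : R} (hpq : p = q) {n m : ℕ} (h : m ≤ n) :
    ∃ g : (R ⧸ Ideal.span {p ^ n}) →ₗ[R] (R ⧸ Ideal.span {q ^ m}),
      ∀ c y, q ^ c • g y = 0 → p ^ (c + (n - m)) • y = 0 := by
  subst hpq
  obtain ⟨g, hg⟩ := exists_linearMap_mk_eq_mk p h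
  refine ⟨g, fun c y hy ↦ ?_⟩
  obtain ⟨x, rfl⟩ := Ideal.Quotient.mk_surjective y
  rw [hg, pow_smul_mk_eq_zero_iff] at hy
  rw [pow_smul_mk_eq_zero_iff, add_comm, pow_add, mul_assoc]
  conv_lhs => rw [← Nat.sub_add_cancel h, pow_add]
  exact mul_dvd_mul_left _ hy

end PrimePowerQuotient

/-! ### Hyperinvariant submodules and admissible exponents -/

section Hyperinvariant

variable {R : Type*} [CommRing R] {ι : Type*} {p : ι → R} {n : ι → ℕ} {M : Type*}
  [AddCommGroup M] [Module R M]

/-- The exponents `b` for which `{v | ∀ i, p i ^ b i • v i = 0}` is a hyperinvariant submodule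
of `⨁ i, R ⧸ p i ^ n i`. -/
structure IsAdmissibleExponent (p : ι → R) (n b : ι → ℕ) : Prop where
  le : ∀ i, b i ≤ n i
  mono : ∀ i j, p i = p j → n i ≤ n j → b i ≤ b j
  lipschitz : ∀ i j, p i = p j → n i ≤ n j → b j + n i ≤ b i + n j

/-- The endomorphism of `M ≃ ∏ i, R ⧸ p i ^ n i` given by a map from one factor to another. -/
def blockEnd [DecidableEq ι] (E : M ≃ₗ[R] ∀ i, R ⧸ Ideal.span {p i ^ n i}) (i j : ι)
    (g : (R ⧸ Ideal.span {p i ^ n i}) →ₗ[R] (R ⧸ Ideal.span {p j ^ n j})) : Module.End R M :=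
  E.symm.toLinearMap ∘ₗ LinearMap.single R _ j ∘ₗ g ∘ₗ LinearMap.proj i ∘ₗ E.toLinearMap

theorem blockEnd_apply [DecidableEq ι] (E : M ≃ₗ[R] ∀ i, R ⧸ Ideal.span {p i ^ n i}) (i j : ι)
    (g : (R ⧸ Ideal.span {p i ^ n i}) →ₗ[R] (R ⧸ Ideal.span {p j ^ n j})) (v : M) :
    E (blockEnd E i j g v) = Pi.single j (g (E v i)) := by
  simp [blockEnd]

variable [IsDomain R] [Fintype ι] [DecidableEq ι]

/-- The hyperinvariant submodule with exponents `b`. -/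
def hyperinvariantSubmodule (hp : ∀ i, Prime (p i)) (hcop : ∀ i j, p i = p j ∨ IsCoprime (p i) (p j))
    (E : M ≃ₗ[R] ∀ i, R ⧸ Ideal.span {p i ^ n i}) {b : ι → ℕ} (hb : IsAdmissibleExponent p n b) :
    Submodule (Module.End R M) M where
  carrier := {v | ∀ i, p i ^ b i • E v i = 0}
  zero_mem' i := by simp
  add_mem' {v w} hv hw i := by simp [hv i, hw i]
  smul_mem' f v hv i := by
    -- An endomorphism is the sum of its block entries, so invariance reduces to maps between two
    -- blocks.
    have h : E (f v) i = ∑ j, E (f (E.symm (Pi.single j (E v j)))) i := by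
      rw [← Finset.sum_apply, ← map_sum, ← map_sum, ← map_sum, Finset.univ_sum_single,
        LinearEquiv.symm_apply_apply]
    rw [Module.End.smul_def, h, Finset.smul_sum]
    refine Finset.sum_eq_zero fun j _ ↦ ?_
    exact pow_smul_map_eq_zero (hp j).ne_zero (hcop j i) (hb.le j) (hb.mono j i)
      (fun hji hij ↦ hb.lipschitz i j hji.symm hij)
      (LinearMap.proj i ∘ₗ E.toLinearMap ∘ₗ f ∘ₗ E.symm.toLinearMap ∘ₗ
        LinearMap.single R (fun i ↦ R ⧸ Ideal.span {p i ^ n i}) j)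
      (hv j)

variable (hp : ∀ i, Prime (p i)) (hcop : ∀ i j, p i = p j ∨ IsCoprime (p i) (p j))
  (E : M ≃ₗ[R] ∀ i, R ⧸ Ideal.span {p i ^ n i})

theorem hyperinvariantSubmodule_le_iff {b b' : ι → ℕ} (hb : IsAdmissibleExponent p n b)
    (hb' : IsAdmissibleExponent p n b') :
    hyperinvariantSubmodule hp hcop E hb ≤ hyperinvariantSubmodule hp hcop E hb' ↔ b ≤ b' := by
  constructor
  · intro h i
    have hbi := hb.le i
    -- This test vector is killed by `p i ^ b i` and by no lower power of `p i`.
    have hmem : E.symm (Pi.single i (p i ^ (n i - b i) • 1)) ∈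
        hyperinvariantSubmodule hp hcop E hb := by
      intro j
      rw [LinearEquiv.apply_symm_apply]
      rcases eq_or_ne j i with rfl | hj
      · rw [Pi.single_eq_same, smul_smul, ← pow_add]
        exact pow_smul_quotient_eq_zero (by omega) _
      · rw [Pi.single_eq_of_ne hj, smul_zero]
    have := h hmem i
    rw [LinearEquiv.apply_symm_apply, Pi.single_eq_same, smul_smul, ← pow_add,
      pow_smul_one_quotient_eq_zero_iff (hp i)] at this
    change b i ≤ b' i
    omega
  · intro h v hv i
    rw [← Nat.sub_add_cancel (h i), pow_add, mul_smul, hv i, smul_zero]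

/-- Endomorphisms supported on one block isolate each coordinate, so one vector with a generator in
every coordinate suffices. -/
theorem exists_generator_hyperinvariantSubmodule {b : ι → ℕ} (hb : IsAdmissibleExponent p n b) :
    ∃ v, hyperinvariantSubmodule hp hcop E hb = Submodule.span (Module.End R M) {v} := by
  refine ⟨E.symm fun i ↦ p i ^ (n i - b i) • 1, le_antisymm ?_ ?_⟩
  · intro w hw
    rw [← E.symm_apply_apply w, ← Finset.univ_sum_single (E w), map_sum]
    refine Submodule.sum_mem _ fun i _ ↦ ?_
    obtain ⟨z, hz⟩ := exists_eq_pow_smul_of_pow_smul_eq_zero (hp i).ne_zero (hb.le i) (hw i)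
    have : E.symm (Pi.single i (E w i)) = blockEnd E i i (LinearMap.lsmul R _ z) •
        E.symm fun i ↦ p i ^ (n i - b i) • 1 := by
      rw [LinearEquiv.symm_apply_eq, Module.End.smul_def, blockEnd_apply,
        LinearEquiv.apply_symm_apply, hz, LinearMap.lsmul_apply, smul_comm z]
      congr 2
      rw [Algebra.smul_def, mul_one]
      rfl
    rw [this]
    exact Submodule.smul_mem _ _ (Submodule.mem_span_singleton_self _)
  · rw [Submodule.span_singleton_le_iff_mem]
    intro i
    have := hb.le i
    rw [LinearEquiv.apply_symm_apply, smul_smul, ← pow_add]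
    exact pow_smul_quotient_eq_zero (by omega) _

theorem exists_eq_hyperinvariantSubmodule [IsPrincipalIdealRing R]
    (W : Submodule (Module.End R M) M) :
    ∃ (b : ι → ℕ) (hb : IsAdmissibleExponent p n b), W = hyperinvariantSubmodule hp hcop E hb := by
  classical
  have hex : ∀ i, ∃ a, ∀ v ∈ W, p i ^ a • E v i = 0 :=
    fun i ↦ ⟨n i, fun v _ ↦ pow_smul_quotient_eq_zero le_rfl _⟩
  -- The least exponent annihilating all `i`-th coordinates of `W`. Pushing `W` through embeddings
  -- and projections between blocks forces admissibility.
  let b : ι → ℕ := fun i ↦ Nat.find (hex i)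
  have hbs : ∀ i, ∀ v ∈ W, p i ^ b i • E v i = 0 := fun i ↦ Nat.find_spec (hex i)
  have hbm : ∀ i a, (∀ v ∈ W, p i ^ a • E v i = 0) → b i ≤ a := fun i a h ↦ Nat.find_min' (hex i) h
  have hb : IsAdmissibleExponent p n b := by
    refine ⟨fun i ↦ hbm i _ fun v _ ↦ pow_smul_quotient_eq_zero le_rfl _, fun i j hij h ↦ ?_,
      fun i j hij h ↦ ?_⟩
    · obtain ⟨g, hg⟩ := exists_linearMap_detecting_of_le (hp i).ne_zero hij h
      refine hbm i _ fun v hv ↦ hg _ _ ?_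
      have := hbs j _ (W.smul_mem (blockEnd E i j g) hv)
      rwa [Module.End.smul_def, blockEnd_apply, Pi.single_eq_same] at this
    · obtain ⟨g, hg⟩ := exists_linearMap_detecting_of_ge hij.symm h
      have : b j ≤ b i + (n j - n i) := by
        refine hbm j _ fun v hv ↦ hg _ _ ?_
        have := hbs i _ (W.smul_mem (blockEnd E j i g) hv)
        rwa [Module.End.smul_def, blockEnd_apply, Pi.single_eq_same] at this
      omega
  refine ⟨b, hb, le_antisymm (fun v hv i ↦ hbs i v hv) fun w hw ↦ ?_⟩
  rw [← E.symm_apply_apply w, ← Finset.univ_sum_single (E w), map_sum]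
  refine Submodule.sum_mem _ fun i _ ↦ ?_
  have hwi := hw i
  rcases hbi : b i with _ | a
  · rw [hbi, pow_zero, one_smul] at hwi
    rw [hwi, Pi.single_zero, map_zero]
    exact W.zero_mem
  · have hlt : a < n i := by have := hb.le i; omega
    -- Minimality of `b i` supplies a vector of `W` whose `i`-th coordinate generates the whole `p i
    -- ^ b i`-torsion of that block.
    obtain ⟨v, hv, hva⟩ : ∃ v ∈ W, p i ^ a • E v i ≠ 0 := by
      by_contra! hcon
      have := hbm i a hcon
      omega
    obtain ⟨r, hr⟩ := exists_eq_smul_of_pow_smul_eq_zero (hp i) hlt (hbi ▸ hwi)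
      (hbi ▸ hbs i v hv) hva
    have : E.symm (Pi.single i (E w i)) = blockEnd E i i (LinearMap.lsmul R _ r) • v := by
      rw [LinearEquiv.symm_apply_eq, Module.End.smul_def, blockEnd_apply, hr,
        LinearMap.lsmul_apply]
    rw [this]
    exact W.smul_mem _ hv

end Hyperinvariant

/-! ### Partial sums of block increments -/

section IncrementPoset

variable {B : Set ℕ}

theorem nth_add_blockIncrement (hB : B.Finite) {k : ℕ} (hk : k + 1 < hB.toFinset.card) :
    Nat.nth (· ∈ B) k + blockIncrement B (k + 1) = Nat.nth (· ∈ B) (k + 1) :=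
  Nat.add_sub_of_le (Nat.nth_le_nth_of_lt_card (p := (· ∈ B)) hB k.le_succ hk)

theorem blockIncrement_eq_zero (hB : B.Finite) {k : ℕ} (hk : hB.toFinset.card ≤ k) :
    blockIncrement B k = 0 := by
  have h : Nat.nth (· ∈ B) k = 0 := Nat.nth_of_card_le (p := (· ∈ B)) hB hk
  cases k with
  | zero => exact h
  | succ k => simp [blockIncrement, h]

/-- The partial sum of `r` up to the index of `n` in `B`. -/
noncomputable def partialSumAt (r : IncrementPoset (blockIncrement B)) (n : ℕ) : ℕ :=
  -- `Nat.count` counts elements strictly below `n`, which is the zero-based index of `n` in `B`;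
  -- the `+ 1` includes its own term.
  open Classical in ∑ i ∈ Finset.range (Nat.count (· ∈ B) n + 1), (r i : ℕ)

theorem sum_range_add_nth_le (hB : B.Finite) (r : IncrementPoset (blockIncrement B)) {m k : ℕ}
    (hmk : m ≤ k) (hk : k < hB.toFinset.card) :
    ∑ i ∈ Finset.range (k + 1), (r i : ℕ) + Nat.nth (· ∈ B) m ≤
      ∑ i ∈ Finset.range (m + 1), (r i : ℕ) + Nat.nth (· ∈ B) k := by
  induction k, hmk using Nat.le_induction with
  | base => rfl
  | succ k hmk ih =>
    have h1 := ih (by omega)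
    have h2 := nth_add_blockIncrement hB hk
    have h3 := (r (k + 1)).is_le
    rw [Finset.sum_range_succ]
    omega

theorem partialSumAt_mono (r : IncrementPoset (blockIncrement B)) {m n : ℕ} (hmn : m ≤ n) :
    partialSumAt r m ≤ partialSumAt r n := by
  classical
  refine Finset.sum_le_sum_of_subset (Finset.range_subset_range.2 ?_)
  gcongr

theorem partialSumAt_add_le (hB : B.Finite) (r : IncrementPoset (blockIncrement B)) {m n : ℕ}
    (hm : m ∈ B) (hn : n ∈ B) (hmn : m ≤ n) :
    partialSumAt r n + m ≤ partialSumAt r m + n := by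
  classical
  have h := sum_range_add_nth_le hB r (Nat.count_monotone (· ∈ B) hmn)
    (Nat.count_lt_card (p := (· ∈ B)) hB hn)
  rw [Nat.nth_count hm, Nat.nth_count hn] at h
  exact h

theorem partialSumAt_le (hB : B.Finite) (r : IncrementPoset (blockIncrement B)) {n : ℕ}
    (hn : n ∈ B) : partialSumAt r n ≤ n := by
  classical
  have h := sum_range_add_nth_le hB r (Nat.zero_le _)
    (Nat.count_lt_card (p := (· ∈ B)) hB hn)
  have h0 : (r 0 : ℕ) ≤ Nat.nth (· ∈ B) 0 := (r 0).is_le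
  rw [Nat.nth_count hn] at h
  simp only [zero_add, Finset.range_one, Finset.sum_singleton] at h
  change ∑ i ∈ _, _ ≤ _
  omega

/-- Past the last element of `B` all increments vanish, so the partial sums stay constant there. -/
theorem incrementPoset_le_iff (hB : B.Finite) (r s : IncrementPoset (blockIncrement B)) :
    r ≤ s ↔ ∀ n ∈ B, partialSumAt r n ≤ partialSumAt s n := by
  classical
  refine ⟨fun h n _ ↦ h _, fun h k ↦ ?_⟩
  have key : ∀ k < hB.toFinset.card,
      ∑ i ∈ Finset.range (k + 1), (r i : ℕ) ≤ ∑ i ∈ Finset.range (k + 1), (s i : ℕ) := by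
    intro k hk
    have := h _ (Nat.nth_mem_of_lt_card (p := (· ∈ B)) hB hk)
    unfold partialSumAt at this
    rwa [Nat.count_nth_of_lt_card_finite (p := (· ∈ B)) hB hk] at this
  induction k with
  | zero =>
    rcases lt_or_ge 0 hB.toFinset.card with hk | hk
    · exact key 0 hk
    · have := (r 0).is_le
      have hz := blockIncrement_eq_zero hB hk
      simp only [zero_add, Finset.range_one, Finset.sum_singleton]
      omega
  | succ k ih =>
    rcases lt_or_ge (k + 1) hB.toFinset.card with hk | hk
    · exact key _ hk
    · have := (r (k + 1)).is_le
      have hz := blockIncrement_eq_zero hB hk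
      rw [Finset.sum_range_succ, Finset.sum_range_succ (fun i ↦ (s i : ℕ))]
      omega

theorem exists_partialSumAt_eq (hB : B.Finite) (β : ℕ → ℕ) (hle : ∀ n ∈ B, β n ≤ n)
    (hmono : ∀ m ∈ B, ∀ n ∈ B, m ≤ n → β m ≤ β n)
    (hlip : ∀ m ∈ B, ∀ n ∈ B, m ≤ n → β n + m ≤ β m + n) :
    ∃ r : IncrementPoset (blockIncrement B), ∀ n ∈ B, partialSumAt r n = β n := by
  classical
  have hmem : ∀ k < hB.toFinset.card, Nat.nth (· ∈ B) k ∈ B :=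
    fun k hk ↦ Nat.nth_mem_of_lt_card (p := (· ∈ B)) hB hk
  have hle' : ∀ k, k + 1 < hB.toFinset.card → Nat.nth (· ∈ B) k ≤ Nat.nth (· ∈ B) (k + 1) :=
    fun k hk ↦ Nat.nth_le_nth_of_lt_card (p := (· ∈ B)) hB k.le_succ hk
  let ρ : ℕ → ℕ
    | 0 => β (Nat.nth (· ∈ B) 0)
    | k + 1 => β (Nat.nth (· ∈ B) (k + 1)) - β (Nat.nth (· ∈ B) k)
  -- The `min` makes every entry legal. Below `card B` it is inactive, by `hle` at zero and `hlip`
  -- afterwards; beyond, it gives zero.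
  refine ⟨fun k ↦ Fin.ofNat _ (min (ρ k) (blockIncrement B k)), fun n hn ↦ ?_⟩
  have hval : ∀ k, ((Fin.ofNat (blockIncrement B k + 1) (min (ρ k) (blockIncrement B k)) :
      Fin (blockIncrement B k + 1)) : ℕ) = min (ρ k) (blockIncrement B k) :=
    fun k ↦ Nat.mod_eq_of_lt (by omega)
  have key : ∀ k < hB.toFinset.card,
      ∑ i ∈ Finset.range (k + 1), min (ρ i) (blockIncrement B i) = β (Nat.nth (· ∈ B) k) := by
    intro k hk
    induction k with
    | zero =>
      simp only [zero_add, Finset.range_one, Finset.sum_singleton]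
      exact min_eq_left (hle _ (hmem 0 hk))
    | succ k ih =>
      have h1 := hmono _ (hmem k (by omega)) _ (hmem _ hk) (hle' k hk)
      have h2 := hlip _ (hmem k (by omega)) _ (hmem _ hk) (hle' k hk)
      have h3 := nth_add_blockIncrement hB hk
      have h4 : ρ (k + 1) = β (Nat.nth (· ∈ B) (k + 1)) - β (Nat.nth (· ∈ B) k) := rfl
      rw [Finset.sum_range_succ, ih (by omega)]
      omega
  unfold partialSumAt
  simp only [hval]
  rw [key _ (Nat.count_lt_card (p := (· ∈ B)) hB hn), Nat.nth_count hn]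

end IncrementPoset

/-! ### An intrinsic description of block sizes -/

section BlockSizes

variable {R : Type*} [CommRing R]

/-- The socle of `q` contains an element divisible by exactly `q ^ n`. -/
def HasSocleHeight (q : R) (M : Type*) [AddCommGroup M] [Module R M] (n : ℕ) : Prop :=
  ∃ u : M, q ^ (n + 1) • u = 0 ∧ ∀ w : M, q ^ n • u ≠ q ^ (n + 1) • w

theorem hasSocleHeight_congr {q : R} {M N : Type*} [AddCommGroup M] [Module R M]
    [AddCommGroup N] [Module R N] (e : M ≃ₗ[R] N) {n : ℕ} :
    HasSocleHeight q M n ↔ HasSocleHeight q N n := by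
  refine ⟨fun ⟨u, hu, hu'⟩ ↦ ⟨e u, ?_, fun w hw ↦ hu' (e.symm w) ?_⟩,
    fun ⟨u, hu, hu'⟩ ↦ ⟨e.symm u, ?_, fun w hw ↦ hu' (e w) ?_⟩⟩
  · rw [← map_smul, hu, map_zero]
  · rw [← map_smul, e.eq_symm_apply, map_smul, hw]
  · rw [← map_smul, hu, map_zero]
  · rw [← map_smul, ← hw, map_smul, e.apply_symm_apply]

theorem hasSocleHeight_pi_iff {q : R} {ι : Type*} {Q : ι → Type*}
    [∀ i, AddCommGroup (Q i)] [∀ i, Module R (Q i)] {n : ℕ} :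
    HasSocleHeight q (∀ i, Q i) n ↔ ∃ i, HasSocleHeight q (Q i) n := by
  classical
  constructor
  · rintro ⟨u, hu, hu'⟩
    by_contra! hcon
    have : ∀ i, ∃ w, q ^ n • u i = q ^ (n + 1) • w := by
      intro i
      by_contra! h
      exact hcon i ⟨u i, congrFun hu i, h⟩
    choose w hw using this
    exact hu' w (funext hw)
  · rintro ⟨i, u, hu, hu'⟩
    refine ⟨Pi.single i u, ?_, fun w hw ↦ hu' (w i) ?_⟩
    · rw [← Pi.single_smul, hu, Pi.single_zero]
    · have := congrFun hw i
      rwa [Pi.smul_apply, Pi.single_eq_same] at this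

/-- If `m ≤ n` then `p ^ n` kills everything; if `m > n + 1` then `u` is itself divisible by `p`.
Only `m = n + 1` leaves a witness, namely `1`. -/
theorem hasSocleHeight_quotient_iff [IsDomain R] {p q : R} (hp : Prime p)
    (h : p = q ∨ IsCoprime p q) (hpq : p = q → ¬ IsCoprime p q) {m n : ℕ} :
    HasSocleHeight q (R ⧸ Ideal.span {p ^ m}) n ↔ p = q ∧ m = n + 1 := by
  constructor
  · rintro ⟨u, hu, hu'⟩
    rcases h with rfl | h
    · refine ⟨rfl, ?_⟩
      by_contra hne
      rcases lt_or_gt_of_ne hne with hlt | hlt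
      · refine hu' 0 ?_
        rw [smul_zero]
        exact pow_smul_quotient_eq_zero (by omega) _
      · obtain ⟨z, rfl⟩ := exists_eq_pow_smul_of_pow_smul_eq_zero hp.ne_zero hlt.le hu
        refine hu' (p ^ (m - (n + 1) - 1) • Ideal.Quotient.mk _ z) ?_
        rw [smul_smul, smul_smul, ← pow_add, ← pow_add]
        congr 2
        omega
    · refine absurd ?_ (hu' 0)
      rw [eq_zero_of_isCoprime_of_pow_smul_eq_zero h (pow_smul_quotient_eq_zero le_rfl u) hu]
      simp
  · rintro ⟨rfl, rfl⟩
    refine ⟨1, pow_smul_quotient_eq_zero le_rfl _, fun w hw ↦ ?_⟩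
    rw [pow_smul_quotient_eq_zero le_rfl, pow_smul_one_quotient_eq_zero_iff hp] at hw
    omega

end BlockSizes

/-! ### Jordan decompositions: invariance and existence -/

section JordanDecomposition

variable {V : Type*} [AddCommGroup V] [Module ℂ V] {T : Module.End ℂ V}

theorem X_sub_C_eq_or_isCoprime (a b : ℂ) :
    X - C a = X - C b ∨ IsCoprime (X - C a) (X - C b) := by
  rcases eq_or_ne a b with rfl | h
  · exact Or.inl rfl
  · exact Or.inr (isCoprime_X_sub_C_of_isUnit_sub (sub_ne_zero.2 h).isUnit)

theorem X_sub_C_inj {a b : ℂ} : X - C a = X - C b ↔ a = b := by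
  rw [sub_right_inj, C_inj]

namespace JordanDecomposition

variable (D : JordanDecomposition T)

/-- A Jordan decomposition as an isomorphism with a product. -/
noncomputable def equivPi : Module.AEval' T ≃ₗ[ℂ[X]]
    ∀ j : Fin D.numBlocks, ℂ[X] ⧸ Ideal.span {(X - C (D.eigenvalue j)) ^ D.size j} :=
  D.equiv.trans (DirectSum.linearEquivFunOnFintype _ _ _)

/-- The right side does not involve `D`, so all Jordan decompositions have the same block sizes. -/
theorem exists_block_iff {μ : ℂ} {n : ℕ} :
    (∃ j, D.eigenvalue j = μ ∧ D.size j = n + 1) ↔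
      HasSocleHeight (X - C μ) (Module.AEval' T) n := by
  rw [hasSocleHeight_congr D.equivPi, hasSocleHeight_pi_iff]
  refine exists_congr fun j ↦ ?_
  rw [hasSocleHeight_quotient_iff (prime_X_sub_C _) (X_sub_C_eq_or_isCoprime _ _), X_sub_C_inj]
  intro h h'
  rw [h, isCoprime_self] at h'
  exact (prime_X_sub_C μ).not_isUnit h'

theorem mem_jordanBlockSizes_iff {μ : ℂ} {n : ℕ} :
    n ∈ jordanBlockSizes T μ ↔ ∃ j, D.eigenvalue j = μ ∧ D.size j = n := by
  refine ⟨fun ⟨D', j, hj, hn⟩ ↦ ?_, fun ⟨j, hj⟩ ↦ ⟨D, j, hj⟩⟩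
  obtain ⟨n, rfl⟩ : ∃ k, n = k + 1 := ⟨n - 1, by have := D'.size_pos j; omega⟩
  exact D.exists_block_iff.2 (D'.exists_block_iff.1 ⟨j, hj, hn⟩)

theorem finite_jordanBlockSizes (D : JordanDecomposition T) (μ : ℂ) : (jordanBlockSizes T μ).Finite := by
  refine (Set.finite_range D.size).subset fun n hn ↦ ?_
  obtain ⟨j, -, hj⟩ := D.mem_jordanBlockSizes_iff.1 hn
  exact ⟨j, hj⟩

theorem hasEigenvalue (j : Fin D.numBlocks) : T.HasEigenvalue (D.eigenvalue j) := by
  classical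
  have hpos := D.size_pos j
  -- A generator of the socle of block `j`, hence an eigenvector.
  let v : Module.AEval' T := D.equivPi.symm
    (Pi.single j ((X - C (D.eigenvalue j)) ^ (D.size j - 1) • 1))
  have hv : v ≠ 0 := by
    rw [Ne, LinearEquiv.map_eq_zero_iff, Pi.single_eq_zero_iff,
      pow_smul_one_quotient_eq_zero_iff (prime_X_sub_C _)]
    omega
  have hv' : (X - C (D.eigenvalue j)) • v = 0 := by
    rw [← map_smul, ← Pi.single_smul, smul_smul, ← pow_succ',
      pow_smul_quotient_eq_zero (by omega), Pi.single_zero, map_zero]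
  have := congrArg (Module.AEval'.of T).symm hv'
  rw [sub_smul, map_sub, Module.AEval'.of_symm_X_smul, Module.AEval.C_smul, map_smul, map_zero,
    sub_eq_zero] at this
  refine Module.End.hasEigenvalue_of_hasEigenvector
    (x := (Module.AEval'.of T).symm v) ⟨Module.End.mem_eigenspace_iff.2 this, ?_⟩
  rwa [Ne, LinearEquiv.map_eq_zero_iff]

end JordanDecomposition

theorem exists_jordanDecomposition [FiniteDimensional ℂ V] (T : Module.End ℂ V) :
    Nonempty (JordanDecomposition T) := by
  classical
  obtain ⟨ι, _, p, hp, e, ⟨E⟩⟩ := Module.equiv_directSum_of_isTorsion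
    (Module.AEval.isTorsion_of_finiteDimensional ℂ V T)
  have hroot : ∀ i, ∃ a, Ideal.span {p i ^ e i} = Ideal.span {(X - C a) ^ e i} := by
    intro i
    obtain ⟨a, ha⟩ := IsAlgClosed.exists_root (p i) (degree_pos_of_irreducible (hp i)).ne'
    refine ⟨a, Ideal.span_singleton_eq_span_singleton.2 (Associated.pow_pow ?_)⟩
    exact ((prime_X_sub_C a).irreducible.associated_of_dvd (hp i) (dvd_iff_isRoot.2 ha)).symm
  choose a ha using hroot
  -- The structure theorem allows exponent zero; these trivial factors are dropped to meet
  -- `size_pos`.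
  let S := {i // 0 < e i}
  let σ : Fin (Fintype.card S) ≃ S := (Fintype.equivFin S).symm
  have hsub : ∀ i, ¬ 0 < e i → Subsingleton (ℂ[X] ⧸ Ideal.span {p i ^ e i}) := by
    intro i hi
    rw [Nat.eq_zero_of_not_pos hi, pow_zero, Ideal.span_singleton_one]
    exact Ideal.Quotient.subsingleton_iff.2 rfl
  let F : (∀ i, ℂ[X] ⧸ Ideal.span {p i ^ e i}) ≃ₗ[ℂ[X]]
      ∀ i : S, ℂ[X] ⧸ Ideal.span {p i ^ e i} :=
    LinearEquiv.ofBijective (LinearMap.pi fun i ↦ LinearMap.proj i.1) <| by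
      refine ⟨fun x y hxy ↦ funext fun i ↦ ?_, fun y ↦
        ⟨fun i ↦ if hi : 0 < e i then y ⟨i, hi⟩ else 0, funext fun i ↦ dif_pos i.2⟩⟩
      by_cases hi : 0 < e i
      · exact congrFun hxy ⟨i, hi⟩
      · have := hsub i hi
        exact Subsingleton.elim _ _
  exact ⟨{
    numBlocks := Fintype.card S
    eigenvalue := fun j ↦ a (σ j)
    size := fun j ↦ e (σ j)
    size_pos := fun j ↦ (σ j).2
    equiv := E.trans <| (DirectSum.linearEquivFunOnFintype _ _ _).trans <| F.trans <|
      (LinearEquiv.piCongrLeft' ℂ[X] _ σ.symm).trans <|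
      (LinearEquiv.piCongrRight fun j ↦ Submodule.quotEquivOfEq _ _ (ha (σ j))).trans
      (DirectSum.linearEquivFunOnFintype _ _ _).symm }⟩

end JordanDecomposition

/-! ### The lattice of hyperinvariant subspaces -/

section HyperinvariantLattice

variable {V : Type*} [AddCommGroup V] [Module ℂ V] {T : Module.End ℂ V}

/-- The lattice of hyperinvariant subspaces of `T`. -/
abbrev HyperinvariantSubspace (T : Module.End ℂ V) : Type _ :=
  Submodule (Module.End ℂ[X] (Module.AEval' T)) (Module.AEval' T)

namespace JordanDecomposition

variable (D : JordanDecomposition T)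

/-- The exponents of the hyperinvariant subspace given by block increments `r`. -/
noncomputable def exponent
    (r : ∀ μ : T.Eigenvalues, IncrementPoset (blockIncrement (jordanBlockSizes T (μ : ℂ))))
    (j : Fin D.numBlocks) : ℕ :=
  partialSumAt (r ⟨D.eigenvalue j, D.hasEigenvalue j⟩) (D.size j)

theorem size_mem (j : Fin D.numBlocks) : D.size j ∈ jordanBlockSizes T (D.eigenvalue j) :=
  ⟨D, j, rfl, rfl⟩

theorem isAdmissibleExponent_exponent
    (r : ∀ μ : T.Eigenvalues, IncrementPoset (blockIncrement (jordanBlockSizes T (μ : ℂ)))) :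
    IsAdmissibleExponent (fun j ↦ X - C (D.eigenvalue j)) D.size (D.exponent r) where
  le j := partialSumAt_le (D.finite_jordanBlockSizes _) _ (D.size_mem j)
  mono i j hij h := by
    have hμ : (⟨D.eigenvalue i, D.hasEigenvalue i⟩ : T.Eigenvalues) =
        ⟨D.eigenvalue j, D.hasEigenvalue j⟩ := Subtype.ext (X_sub_C_inj.1 hij)
    unfold exponent
    rw [hμ]
    exact partialSumAt_mono _ h
  lipschitz i j hij h := by
    have hμ : (⟨D.eigenvalue i, D.hasEigenvalue i⟩ : T.Eigenvalues) =
        ⟨D.eigenvalue j, D.hasEigenvalue j⟩ := Subtype.ext (X_sub_C_inj.1 hij)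
    unfold exponent
    rw [hμ]
    refine partialSumAt_add_le (D.finite_jordanBlockSizes _) _ ?_ (D.size_mem j) h
    change D.size i ∈ jordanBlockSizes T (D.eigenvalue j)
    rw [← X_sub_C_inj.1 hij]
    exact D.size_mem i

theorem exponent_le_iff
    (r s : ∀ μ : T.Eigenvalues, IncrementPoset (blockIncrement (jordanBlockSizes T (μ : ℂ)))) :
    D.exponent r ≤ D.exponent s ↔ r ≤ s := by
  constructor
  · rintro h ⟨μ, hμ⟩
    rw [incrementPoset_le_iff (D.finite_jordanBlockSizes _)]
    intro n hn
    obtain ⟨j, rfl, rfl⟩ := D.mem_jordanBlockSizes_iff.1 hn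
    exact h j
  · intro h j
    exact (incrementPoset_le_iff (D.finite_jordanBlockSizes _) _ _).1
      (h ⟨D.eigenvalue j, D.hasEigenvalue j⟩) _ (D.size_mem j)

theorem exists_exponent_eq {b : Fin D.numBlocks → ℕ}
    (hb : IsAdmissibleExponent (fun j ↦ X - C (D.eigenvalue j)) D.size b) :
    ∃ r, D.exponent r = b := by
  classical
  have h : ∀ μ : T.Eigenvalues,
      ∃ r : IncrementPoset (blockIncrement (jordanBlockSizes T (μ : ℂ))),
        ∀ j, D.eigenvalue j = μ → partialSumAt r (D.size j) = b j := by
    intro μ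
    -- Monotonicity makes `b` a function of block size within one eigenvalue; the supremum realizes
    -- it without choosing a block.
    let β : ℕ → ℕ := fun n ↦
      Finset.sup (Finset.univ.filter fun j ↦ D.eigenvalue j = μ ∧ D.size j ≤ n) b
    have hβ : ∀ j, D.eigenvalue j = μ → β (D.size j) = b j := by
      intro j hj
      refine le_antisymm (Finset.sup_le fun i hi ↦ ?_) (Finset.le_sup ?_)
      · obtain ⟨hi, hij⟩ := (Finset.mem_filter.1 hi).2
        exact hb.mono i j (X_sub_C_inj.2 (hi.trans hj.symm)) hij
      · simpa using hj
    have hmem : ∀ n ∈ jordanBlockSizes T (μ : ℂ), ∃ j, D.eigenvalue j = μ ∧ D.size j = n :=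
      fun n hn ↦ D.mem_jordanBlockSizes_iff.1 hn
    have hle : ∀ n ∈ jordanBlockSizes T (μ : ℂ), β n ≤ n := by
      intro n hn
      obtain ⟨j, hj, rfl⟩ := hmem n hn
      rw [hβ j hj]
      exact hb.le j
    have hmono : ∀ m ∈ jordanBlockSizes T (μ : ℂ), ∀ n ∈ jordanBlockSizes T (μ : ℂ),
        m ≤ n → β m ≤ β n := by
      intro m hm n hn
      obtain ⟨i, hi, rfl⟩ := hmem m hm
      obtain ⟨j, hj, rfl⟩ := hmem n hn
      rw [hβ i hi, hβ j hj]
      exact hb.mono i j (X_sub_C_inj.2 (hi.trans hj.symm))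
    have hlip : ∀ m ∈ jordanBlockSizes T (μ : ℂ), ∀ n ∈ jordanBlockSizes T (μ : ℂ),
        m ≤ n → β n + m ≤ β m + n := by
      intro m hm n hn
      obtain ⟨i, hi, rfl⟩ := hmem m hm
      obtain ⟨j, hj, rfl⟩ := hmem n hn
      rw [hβ i hi, hβ j hj]
      exact hb.lipschitz i j (X_sub_C_inj.2 (hi.trans hj.symm))
    obtain ⟨r, hr⟩ := exists_partialSumAt_eq (D.finite_jordanBlockSizes μ) β hle hmono hlip
    refine ⟨r, fun j hj ↦ ?_⟩
    rw [hr _ (D.mem_jordanBlockSizes_iff.2 ⟨j, hj, rfl⟩), hβ j hj]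
  choose r hr using h
  exact ⟨r, funext fun j ↦ hr _ j rfl⟩

theorem exists_orderIso_hyperinvariantSubspace (D : JordanDecomposition T) :
    Nonempty (HyperinvariantSubspace T ≃o
      ∀ μ : T.Eigenvalues, IncrementPoset (blockIncrement (jordanBlockSizes T (μ : ℂ)))) := by
  have hp : ∀ j, Prime (X - C (D.eigenvalue j)) := fun j ↦ prime_X_sub_C _
  have hcop := fun i j ↦ X_sub_C_eq_or_isCoprime (D.eigenvalue i) (D.eigenvalue j)
  let f : (∀ μ : T.Eigenvalues, IncrementPoset (blockIncrement (jordanBlockSizes T (μ : ℂ)))) ↪o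
      HyperinvariantSubspace T := OrderEmbedding.ofMapLEIff
    (fun r ↦ hyperinvariantSubmodule hp hcop D.equivPi (D.isAdmissibleExponent_exponent r))
    fun r s ↦ (hyperinvariantSubmodule_le_iff _ _ _ _ _).trans (D.exponent_le_iff r s)
  refine ⟨(RelIso.ofSurjective f fun W ↦ ?_).symm⟩
  obtain ⟨b, hb, rfl⟩ := exists_eq_hyperinvariantSubmodule hp hcop D.equivPi W
  obtain ⟨r, rfl⟩ := D.exists_exponent_eq hb
  exact ⟨r, rfl⟩

theorem exists_eq_span_singleton (D : JordanDecomposition T) (W : HyperinvariantSubspace T) :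
    ∃ v : V, W = Submodule.span _ {Module.AEval'.of T v} := by
  obtain ⟨b, hb, rfl⟩ := exists_eq_hyperinvariantSubmodule (fun j ↦ prime_X_sub_C _)
    (fun i j ↦ X_sub_C_eq_or_isCoprime (D.eigenvalue i) (D.eigenvalue j)) D.equivPi W
  obtain ⟨v, hv⟩ := exists_generator_hyperinvariantSubmodule (fun j ↦ prime_X_sub_C _)
    (fun i j ↦ X_sub_C_eq_or_isCoprime (D.eigenvalue i) (D.eigenvalue j)) D.equivPi hb
  exact ⟨(Module.AEval'.of T).symm v, by rw [LinearEquiv.apply_symm_apply, hv]⟩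

end JordanDecomposition

end HyperinvariantLattice

/-! ### Orbits, their closures and cyclic submodules -/

section Orbits

variable {V : Type*} [AddCommGroup V] [Module ℂ V] {T : Module.End ℂ V}

theorem of_mem_span_singleton_iff {v w : V} :
    Module.AEval'.of T w ∈
        Submodule.span (Module.End ℂ[X] (Module.AEval' T)) {Module.AEval'.of T v} ↔
      ∃ S : Module.End ℂ V, S * T = T * S ∧ S v = w := by
  rw [Submodule.mem_span_singleton]
  constructor
  · rintro ⟨f, hf⟩
    refine ⟨(Module.AEval'.of T).symm.toLinearMap ∘ₗ f.restrictScalars ℂ ∘ₗ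
      (Module.AEval'.of T).toLinearMap, LinearMap.ext fun x ↦ ?_, ?_⟩
    · simp only [Module.End.mul_apply, LinearMap.comp_apply, LinearEquiv.coe_coe,
        LinearMap.coe_restrictScalars]
      rw [← Module.AEval'.X_smul_of, map_smul, Module.AEval'.of_symm_X_smul]
    · simp only [LinearMap.comp_apply, LinearEquiv.coe_coe, LinearMap.coe_restrictScalars]
      rw [← Module.End.smul_def, hf, LinearEquiv.symm_apply_apply]
  · rintro ⟨S, hS, rfl⟩
    refine ⟨LinearMap.ofAEval T ((Module.AEval'.of T).toLinearMap ∘ₗ S) fun m ↦ ?_, rfl⟩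
    simp only [LinearMap.comp_apply, LinearEquiv.coe_coe, Module.End.smul_def]
    rw [Module.AEval'.X_smul_of]
    exact congrArg _ (LinearMap.congr_fun hS m)

/-- A hyperinvariant subspace as a complex subspace of `V`. -/
def HyperinvariantSubspace.toSubmodule (W : HyperinvariantSubspace T) : Submodule ℂ V where
  carrier := {w | Module.AEval'.of T w ∈ W}
  zero_mem' := by simp
  add_mem' {v w} hv hw := by
    rw [Set.mem_ofPred_eq, map_add]
    exact W.add_mem hv hw
  smul_mem' c v hv := by
    rw [Set.mem_ofPred_eq, map_smul, ← Module.AEval.C_smul]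
    exact W.smul_mem (LinearMap.lsmul ℂ[X] _ (C c)) hv

theorem HyperinvariantSubspace.mem_toSubmodule {W : HyperinvariantSubspace T} {w : V} :
    w ∈ W.toSubmodule ↔ Module.AEval'.of T w ∈ W :=
  Iff.rfl

theorem exists_centralizerGroup_smul_eq {S : Module.End ℂ V} (hS : S * T = T * S)
    (hu : IsUnit S) : ∃ U : centralizerGroup T, ∀ v : V, U • v = S v :=
  ⟨⟨hu.unit, hS⟩, fun _ ↦ rfl⟩

theorem centralizerGroup_smul (U : centralizerGroup T) :
    ∃ S : Module.End ℂ V, S * T = T * S ∧ ∀ v, S v = U • v :=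
  ⟨U.1.1, U.2, fun _ ↦ rfl⟩

theorem add_smul_one_commute {S : Module.End ℂ V} (hS : S * T = T * S) (t : ℂ) :
    (S + t • 1) * T = T * (S + t • 1) := by
  rw [add_mul, mul_add, hS, smul_mul_assoc, mul_smul_comm, one_mul, mul_one]

theorem finite_setOf_not_isUnit_add_smul_one [FiniteDimensional ℂ V] (S : Module.End ℂ V) :
    {t : ℂ | ¬ IsUnit (S + t • 1)}.Finite := by
  refine (Module.End.finite_spectrum (-S)).subset fun t ht ↦ ?_
  rw [spectrum.mem_iff, sub_neg_eq_add, add_comm, Algebra.algebraMap_eq_smul_one]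
  exact ht

theorem mem_orbit_of_mutually_cyclic [FiniteDimensional ℂ V] {S S' : Module.End ℂ V}
    (hS : S * T = T * S) (hS' : S' * T = T * S') {v w : V} (hv : S v = w) (hw : S' w = v) :
    w ∈ MulAction.orbit (centralizerGroup T) v := by
  -- Choose `t ≠ 0` with both `1 + t S` and `S' + t` invertible. Then `(1 + t S) v = v + t w = (S' +
  -- t) w` joins the two orbits.
  obtain ⟨t, ht⟩ := ((finite_setOf_not_isUnit_add_smul_one S').union
    (((finite_setOf_not_isUnit_add_smul_one S).image (·⁻¹)).union
      (Set.finite_singleton 0))).exists_notMem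
  simp only [Set.mem_union, Set.mem_ofPred_eq, Set.mem_image, Set.mem_singleton_iff, not_or,
    not_not, not_exists, not_and] at ht
  obtain ⟨h1, h2, h3⟩ := ht
  have h4 : IsUnit (t • S + 1) := by
    have h5 : IsUnit (S + t⁻¹ • 1) := by
      by_contra h
      exact h2 t⁻¹ h (inv_inv t)
    have h6 := h5.smul (Units.mk0 t h3)
    rwa [Units.smul_mk0, smul_add, smul_smul, mul_inv_cancel₀ h3, one_smul] at h6
  obtain ⟨U, hU⟩ := exists_centralizerGroup_smul_eq (T := T) (by
    rw [add_mul, mul_add, smul_mul_assoc, mul_smul_comm, hS, one_mul, mul_one]) h4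
  obtain ⟨U', hU'⟩ := exists_centralizerGroup_smul_eq (add_smul_one_commute hS' t) h1
  have key : U • v = U' • w := by
    rw [hU, hU']
    simp [hv, hw, add_comm]
  exact ⟨U'⁻¹ * U, by rw [← inv_smul_smul U' w, ← key, ← mul_smul]⟩

/-- The cyclic submodule is closed because it is a finite-dimensional subspace; conversely `S v` is
the limit of `(S + t) v` through invertible `S + t`. -/
theorem closure_orbit_eq [FiniteDimensional ℂ V]
    [TopologicalSpace V] [IsTopologicalAddGroup V] [ContinuousSMul ℂ V] [T2Space V] (v : V) :
    closure (MulAction.orbit (centralizerGroup T) v) =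
      (HyperinvariantSubspace.toSubmodule (T := T)
        (Submodule.span _ {Module.AEval'.of T v}) : Set V) := by
  apply Set.Subset.antisymm
  · refine closure_minimal ?_ (Submodule.closed_of_finiteDimensional _)
    rintro _ ⟨U, rfl⟩
    obtain ⟨S, hS, hSU⟩ := centralizerGroup_smul U
    exact of_mem_span_singleton_iff.2 ⟨S, hS, hSU v⟩
  · intro w hw
    obtain ⟨S, hS, rfl⟩ := of_mem_span_singleton_iff.1 hw
    have hlim : Filter.Tendsto (fun t : ℂ ↦ (S + t • 1) v) (nhdsWithin 0 {0}ᶜ) (nhds (S v)) := by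
      have : Filter.Tendsto (fun t : ℂ ↦ S v + t • v) (nhds 0) (nhds (S v + (0 : ℂ) • v)) :=
        (continuous_const.add (continuous_id.smul continuous_const)).tendsto 0
      rw [zero_smul, add_zero] at this
      exact this.mono_left nhdsWithin_le_nhds
    refine mem_closure_of_tendsto hlim ?_
    have hunit : ∀ᶠ t in nhdsWithin (0 : ℂ) {0}ᶜ, IsUnit (S + t • 1) := by
      have h : ∀ᶠ t in Filter.cofinite, IsUnit (S + (t : ℂ) • 1) :=
        finite_setOf_not_isUnit_add_smul_one S
      exact h.filter_mono (nhdsNE_le_cofinite 0)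
    filter_upwards [hunit] with t ht
    obtain ⟨U, hU⟩ := exists_centralizerGroup_smul_eq (add_smul_one_commute hS t) ht
    exact ⟨U, hU v⟩

/-- The hyperinvariant subspace generated by an orbit. -/
noncomputable def CentralizerOrbit.span (O : CentralizerOrbit T) : HyperinvariantSubspace T :=
  Submodule.span _ (Module.AEval'.of T '' O.orbit)

theorem CentralizerOrbit.span_mk (v : V) :
    CentralizerOrbit.span (T := T) (Quotient.mk'' v) =
      Submodule.span _ {Module.AEval'.of T v} := by
  apply le_antisymm
  · rw [span, Submodule.span_le]
    rintro _ ⟨_, ⟨U, rfl⟩, rfl⟩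
    obtain ⟨S, hS, hSU⟩ := centralizerGroup_smul U
    exact of_mem_span_singleton_iff.2 ⟨S, hS, hSU v⟩
  · rw [Submodule.span_singleton_le_iff_mem]
    exact Submodule.subset_span ⟨v, MulAction.mem_orbit_self v, rfl⟩

theorem CentralizerOrbit.closure_orbit [FiniteDimensional ℂ V]
    [TopologicalSpace V] [IsTopologicalAddGroup V] [ContinuousSMul ℂ V] [T2Space V]
    (O : CentralizerOrbit T) : closure O.orbit = (O.span.toSubmodule : Set V) := by
  induction O using Quotient.inductionOn' with
  | h v => rw [span_mk, MulAction.orbitRel.Quotient.orbit_mk, closure_orbit_eq]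

theorem CentralizerOrbit.bijective_span [FiniteDimensional ℂ V] :
    Function.Bijective (CentralizerOrbit.span (T := T)) := by
  constructor
  · intro O O'
    induction O using Quotient.inductionOn' with | h v => ?_
    induction O' using Quotient.inductionOn' with | h w => ?_
    rw [span_mk, span_mk]
    intro h
    have hv := Submodule.mem_span_singleton_self
      (R := Module.End ℂ[X] (Module.AEval' T)) (Module.AEval'.of T v)
    have hw := Submodule.mem_span_singleton_self
      (R := Module.End ℂ[X] (Module.AEval' T)) (Module.AEval'.of T w)
    obtain ⟨S, hS, hSv⟩ := of_mem_span_singleton_iff.1 (h ▸ hw)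
    obtain ⟨S', hS', hSw⟩ := of_mem_span_singleton_iff.1 (h ▸ hv)
    exact Quotient.sound' (mem_orbit_of_mutually_cyclic hS' hS hSw hSv)
  · intro W
    obtain ⟨D⟩ := exists_jordanDecomposition T
    obtain ⟨v, rfl⟩ := D.exists_eq_span_singleton W
    exact ⟨Quotient.mk'' v, span_mk v⟩

end Orbits

/-! ### Transport of the lattice to orbits -/

theorem mainTheorem5 {V : Type*} [AddCommGroup V] [Module ℂ V] [FiniteDimensional ℂ V]
    [TopologicalSpace V] [IsTopologicalAddGroup V] [ContinuousSMul ℂ V] [T2Space V]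
    (T : Module.End ℂ V) :
    ∃ _ : Lattice (CentralizerOrbit T),
      (∀ O O' : CentralizerOrbit T, O ≤ O' ↔ closure O.orbit ⊆ closure O'.orbit) ∧
      (∀ O O' : CentralizerOrbit T,
        closure (O ⊔ O').orbit = closure O.orbit + closure O'.orbit) ∧
      (∀ O O' : CentralizerOrbit T,
        closure (O ⊓ O').orbit = closure O.orbit ∩ closure O'.orbit) ∧
      Nonempty (CentralizerOrbit T ≃o
        ∀ μ : T.Eigenvalues, IncrementPoset (blockIncrement (jordanBlockSizes T (μ : ℂ)))) := by
  let e : CentralizerOrbit T ≃ HyperinvariantSubspace T :=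
    Equiv.ofBijective _ CentralizerOrbit.bijective_span
  let : Max (CentralizerOrbit T) := ⟨fun O O' ↦ e.symm (e O ⊔ e O')⟩
  let : Min (CentralizerOrbit T) := ⟨fun O O' ↦ e.symm (e O ⊓ e O')⟩
  let : LE (CentralizerOrbit T) := ⟨fun O O' ↦ e O ≤ e O'⟩
  let : LT (CentralizerOrbit T) := ⟨fun O O' ↦ e O < e O'⟩
  have hsup : ∀ O O', e (O ⊔ O') = e O ⊔ e O' := fun O O' ↦ e.apply_symm_apply _
  have hinf : ∀ O O', e (O ⊓ O') = e O ⊓ e O' := fun O O' ↦ e.apply_symm_apply _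
  let L : Lattice (CentralizerOrbit T) :=
    Function.Injective.lattice e e.injective Iff.rfl Iff.rfl hsup hinf
  have hcl : ∀ O : CentralizerOrbit T, closure O.orbit = ((e O).toSubmodule : Set V) :=
    fun O ↦ O.closure_orbit
  let i : CentralizerOrbit T ≃o HyperinvariantSubspace T := ⟨e, Iff.rfl⟩
  obtain ⟨D⟩ := exists_jordanDecomposition T
  refine ⟨L, fun O O' ↦ ?_, fun O O' ↦ ?_, fun O O' ↦ ?_,
    D.exists_orderIso_hyperinvariantSubspace.map i.trans⟩
  · rw [hcl, hcl]
    exact Iff.rfl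
  · rw [hcl, hcl, hcl, hsup]
    ext w
    rw [SetLike.mem_coe, HyperinvariantSubspace.mem_toSubmodule, Submodule.mem_sup, Set.mem_add]
    exact Iff.rfl
  · rw [hcl, hcl, hcl, hinf]
    rfl
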